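/- Let $\mathfrak g$ be a finite-dimensional complex simple Lie algebra with a basis $(X_A)$, let $B_{AB}$ be the matrix of its Killing form and $B^{AB}$ the inverse matrix. Let $\rho^{(1)},\rho^{(2)}:\mathfrak g\to\mathrm{End}(\mathbb C^d)$ be faithful representations with $\rho^{(1)}$ irreducible, and put $C^{(ij)}=\sum_{A,B}B^{AB}\rho^{(i)}(X_A)\otimes\rho^{(j)}(X_B)$. For $T\in\mathrm{End}(\mathbb C^d)$ write $T_1=T\otimes 1$ and $T_2=1\otimes T$. Let $D\subseteq\mathbb C$ be a set that contains $\{u:|u|>R\}$ for some $R$, and let $\tilde\kappa:D\to\mathrm{End}(\mathbb C^d)$ satisfy the classical boundary Yang–Baxter equation $$\frac{1}{u-v}\Big(C^{(11)}\tilde\kappa_1(u)\tilde\kappa_2(v)-\tilde\kappa_1(u)\tilde\kappa_2(v)C^{(22)}\Big)+\frac{1}{u+v}\Big(\tilde\kappa_1(u)C^{(21)}\tilde\kappa_2(v)-\tilde\kappa_2(v)C^{(12)}\tilde\kappa_1(u)\Big)=0$$ for all $u,v\in D$ with $u\neq\pm v$. If $0\in D$, assume moreover that $D$ is a neighbourhood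 of $0$ and that $\tilde\kappa$ is continuous at $0$. Suppose that $\tilde\kappa(u)=\kappa+\mathcal O(u^{-1})$ as $|u|\to\infty$ with $\kappa$ invertible, and that $\mathrm{Tr}(\tilde\kappa(u)\kappa^{-1})=d$ for all $u\in D$. Then there is a (necessarily unique) Lie algebra automorphism $\alpha$ of $\mathfrak g$ with $\rho^{(1)}(\alpha(X))=\kappa\,\rho^{(2)}(X)\,\kappa^{-1}$ for all $X\in\mathfrak g$, it satisfies $\alpha^2=\mathrm{id}$, and if its invariant subalgebra $\mathfrak h=\{X\in\mathfrak g:\alpha(X)=X\}$ is semisimple, then $\tilde\kappa(u)=\kappa$ for all $u\in D$. -/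

import Mathlib

open scoped Kronecker Topology Asymptotics

-- Matrices carry the commutator bracket.
attribute [local instance 100] LieRing.ofAssociativeRing

namespace ClassicalBYBE

section Defs

variable {𝔤 : Type*} [LieRing 𝔤] [LieAlgebra ℂ 𝔤]

/-- A matrix representation of `𝔤` on `ℂ ^ d` is irreducible: the space is non-zero and its only
invariant subspaces are `0` and the whole space. -/
def IsIrreducibleRep {d : ℕ} (ρ : 𝔤 →ₗ⁅ℂ⁆ Matrix (Fin d) (Fin d) ℂ) : Prop :=
  d ≠ 0 ∧ ∀ W : Submodule ℂ (Fin d → ℂ),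
    (∀ X : 𝔤, ∀ w ∈ W, (ρ X).mulVec w ∈ W) → W = ⊥ ∨ W = ⊤

/-- The invariant element `B^{AB} ρ(X_A) ⊗ σ(X_B)`, where `(X_A)` is a basis of `𝔤` and `B^{AB}` is
the inverse of the matrix of the Killing form in this basis. Matrices on `ℂ ^ d ⊗ ℂ ^ d` are
indexed by `Fin d × Fin d`, and the tensor product of matrices is the Kronecker product. -/
noncomputable def casimir {ι : Type*} [Fintype ι] [DecidableEq ι] (b : Module.Basis ι ℂ 𝔤) {d : ℕ}
    (ρ σ : 𝔤 →ₗ⁅ℂ⁆ Matrix (Fin d) (Fin d) ℂ) :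
    Matrix (Fin d × Fin d) (Fin d × Fin d) ℂ :=
  ∑ i, ∑ j, ((Matrix.of fun k l => killingForm ℂ 𝔤 (b k) (b l))⁻¹ i j) • (ρ (b i) ⊗ₖ σ (b j))

/-- `T ↦ T₁ = T ⊗ 1`. -/
def leg1 {d : ℕ} (T : Matrix (Fin d) (Fin d) ℂ) : Matrix (Fin d × Fin d) (Fin d × Fin d) ℂ :=
  T ⊗ₖ (1 : Matrix (Fin d) (Fin d) ℂ)

/-- `T ↦ T₂ = 1 ⊗ T`. -/
def leg2 {d : ℕ} (T : Matrix (Fin d) (Fin d) ℂ) : Matrix (Fin d × Fin d) (Fin d × Fin d) ℂ :=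
  (1 : Matrix (Fin d) (Fin d) ℂ) ⊗ₖ T

/-- The classical boundary Yang-Baxter equation for `κ`, at spectral parameters `u`, `v` with
`u ≠ v` and `u ≠ -v`. -/
def Equation {ι : Type*} [Fintype ι] [DecidableEq ι] (b : Module.Basis ι ℂ 𝔤) {d : ℕ}
    (ρ₁ ρ₂ : 𝔤 →ₗ⁅ℂ⁆ Matrix (Fin d) (Fin d) ℂ) (κ : ℂ → Matrix (Fin d) (Fin d) ℂ) (u v : ℂ) :
    Prop :=
  (1 / (u - v)) • (casimir b ρ₁ ρ₁ * leg1 (κ u) * leg2 (κ v)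
      - leg1 (κ u) * leg2 (κ v) * casimir b ρ₂ ρ₂)
    + (1 / (u + v)) • (leg1 (κ u) * casimir b ρ₂ ρ₁ * leg2 (κ v)
      - leg2 (κ v) * casimir b ρ₁ ρ₂ * leg1 (κ u)) = 0

/-- `κ` solves the classical boundary Yang-Baxter equation on `D`. -/
def IsSolutionOn {ι : Type*} [Fintype ι] [DecidableEq ι] (b : Module.Basis ι ℂ 𝔤) {d : ℕ}
    (ρ₁ ρ₂ : 𝔤 →ₗ⁅ℂ⁆ Matrix (Fin d) (Fin d) ℂ) (κ : ℂ → Matrix (Fin d) (Fin d) ℂ) (D : Set ℂ) :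
    Prop :=
  ∀ u ∈ D, ∀ v ∈ D, u ≠ v → u ≠ -v → Equation b ρ₁ ρ₂ κ u v

/-- The subalgebra of the elements fixed by a Lie algebra automorphism. -/
def invariantSubalgebra (α : 𝔤 ≃ₗ⁅ℂ⁆ 𝔤) : LieSubalgebra ℂ 𝔤 where
  carrier := {X | α X = X}
  add_mem' := by
    intro X Y hX hY
    change α X = X at hX
    change α Y = Y at hY
    change α (X + Y) = X + Y
    rw [map_add, hX, hY]
  zero_mem' := by simp
  smul_mem' := by
    intro c X hX
    change α X = X at hX
    change α (c • X) = c • X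
    rw [map_smul, hX]
  lie_mem' := by
    intro X Y hX hY
    change α X = X at hX
    change α Y = Y at hY
    change α ⁅X, Y⁆ = ⁅X, Y⁆
    rw [LieEquiv.map_lie, hX, hY]

end Defs

end ClassicalBYBE

/-! Put `k u = κt u * κ⁻¹`, which tends to `1`, and replace `ρ₂` by its conjugate `σ = κ ρ₂ κ⁻¹`.
The equation is then expanded at infinity in each spectral parameter. The leading order
(`leading_order`) makes the mixed Casimir tensor symmetric. This forces `σ` into the image of `ρ₁`,
so `σ = ρ₁ ∘ α`, with `α` self-adjoint for the Killing form; an automorphism is also an isometry,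
whence `α² = 1` (`exists_involution`).

Let `C`, `C'` be the pure and the mixed tensor. First order says that `C + C'` commutes with both
legs of `k u`, so `k u` commutes with `ρ₁(𝔥)`. Let `x` be a limit point of `v (k v - 1)`. Second
order (`second_order`) expresses the commutator of `Q = C - C'` with `k u` through a commutator with
`x`, and its own leading order says that `Q` commutes with `x ⊗ 1 + 1 ⊗ x`.

The crux is `commute_of_killingTensor_symmetric`: `ad x` preserves `ρ₁(𝔤)`, so it acts there as `ad
Y`, where `Y` turns out to lie in the centre of `𝔥`, which is zero. Hence `x` commutes with `ρ₁(𝔤)`,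
the right side of `second_order` vanishes, and for `u ≠ 0` so does the commutator of `Q` with `k u`.
Thus `k u` commutes with `ρ₁(𝔤)`; Schur's lemma and the trace condition give `k u = 1`, and
continuity covers `u = 0`. -/

namespace ClassicalBYBE

open Filter Module

/-! ### Operators on the two tensor factors -/

section Legs

variable {d : ℕ}

lemma leg1_mul (S T : Matrix (Fin d) (Fin d) ℂ) : leg1 (S * T) = leg1 S * leg1 T := by
  simp [leg1, ← Matrix.mul_kronecker_mul]

lemma leg2_mul (S T : Matrix (Fin d) (Fin d) ℂ) : leg2 (S * T) = leg2 S * leg2 T := by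
  simp [leg2, ← Matrix.mul_kronecker_mul]

@[simp] lemma leg1_one : leg1 (1 : Matrix (Fin d) (Fin d) ℂ) = 1 := by simp [leg1]

@[simp] lemma leg2_one : leg2 (1 : Matrix (Fin d) (Fin d) ℂ) = 1 := by simp [leg2]

lemma leg1_smul (c : ℂ) (T : Matrix (Fin d) (Fin d) ℂ) : leg1 (c • T) = c • leg1 T := by
  simp [leg1, Matrix.smul_kronecker]

lemma leg2_smul (c : ℂ) (T : Matrix (Fin d) (Fin d) ℂ) : leg2 (c • T) = c • leg2 T := by
  simp [leg2, Matrix.kronecker_smul]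

lemma leg1_sub (S T : Matrix (Fin d) (Fin d) ℂ) : leg1 (S - T) = leg1 S - leg1 T := by
  ext i j; simp [leg1, Matrix.sub_apply, sub_mul]

lemma leg2_sub (S T : Matrix (Fin d) (Fin d) ℂ) : leg2 (S - T) = leg2 S - leg2 T := by
  ext i j; simp [leg2, Matrix.sub_apply, mul_sub]

lemma leg1_commute_leg2 (S T : Matrix (Fin d) (Fin d) ℂ) : Commute (leg1 S) (leg2 T) := by
  simp [Commute, SemiconjBy, leg1, leg2, ← Matrix.mul_kronecker_mul]

lemma continuous_leg1 : Continuous (leg1 : Matrix (Fin d) (Fin d) ℂ → _) :=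
  continuous_matrix fun i j => by
    simp only [leg1]
    exact (continuous_id.matrix_elem i.1 j.1).mul continuous_const

lemma continuous_leg2 : Continuous (leg2 : Matrix (Fin d) (Fin d) ℂ → _) :=
  continuous_matrix fun i j => by
    simp only [leg2]
    exact continuous_const.mul (continuous_id.matrix_elem i.2 j.2)

end Legs

/-! ### The inverse Killing form as a tensor, and its contractions -/

section KillingTensor

variable {𝔤 : Type*} [LieRing 𝔤] [LieAlgebra ℂ 𝔤] {ι : Type*} [Fintype ι] [DecidableEq ι]
  (b : Basis ι ℂ 𝔤) {d : ℕ}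

/-- The image under `f ⊗ g` of the inverse of the Killing form. -/
noncomputable def killingTensor (f g : 𝔤 →ₗ[ℂ] Matrix (Fin d) (Fin d) ℂ) :
    Matrix (Fin d × Fin d) (Fin d × Fin d) ℂ :=
  ∑ i, ∑ j, ((Matrix.of fun k l => killingForm ℂ 𝔤 (b k) (b l))⁻¹ i j) • (f (b i) ⊗ₖ g (b j))

lemma casimir_eq_killingTensor (ρ σ : 𝔤 →ₗ⁅ℂ⁆ Matrix (Fin d) (Fin d) ℂ) :
    casimir b ρ σ = killingTensor b (ρ : 𝔤 →ₗ[ℂ] _) (σ : 𝔤 →ₗ[ℂ] _) := rfl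

lemma leg1_mul_killingTensor (T : Matrix (Fin d) (Fin d) ℂ) (f g : 𝔤 →ₗ[ℂ] _) :
    leg1 T * killingTensor b f g = killingTensor b (LinearMap.mulLeft ℂ T ∘ₗ f) g := by
  simp [killingTensor, leg1, Finset.mul_sum, ← Matrix.mul_kronecker_mul]

lemma killingTensor_mul_leg1 (T : Matrix (Fin d) (Fin d) ℂ) (f g : 𝔤 →ₗ[ℂ] _) :
    killingTensor b f g * leg1 T = killingTensor b (LinearMap.mulRight ℂ T ∘ₗ f) g := by
  simp [killingTensor, leg1, Finset.sum_mul, ← Matrix.mul_kronecker_mul]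

lemma leg2_mul_killingTensor (T : Matrix (Fin d) (Fin d) ℂ) (f g : 𝔤 →ₗ[ℂ] _) :
    leg2 T * killingTensor b f g = killingTensor b f (LinearMap.mulLeft ℂ T ∘ₗ g) := by
  simp [killingTensor, leg2, Finset.mul_sum, ← Matrix.mul_kronecker_mul]

lemma killingTensor_mul_leg2 (T : Matrix (Fin d) (Fin d) ℂ) (f g : 𝔤 →ₗ[ℂ] _) :
    killingTensor b f g * leg2 T = killingTensor b f (LinearMap.mulRight ℂ T ∘ₗ g) := by
  simp [killingTensor, leg2, Finset.sum_mul, ← Matrix.mul_kronecker_mul]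

lemma killingTensor_add_left (f f' g : 𝔤 →ₗ[ℂ] Matrix (Fin d) (Fin d) ℂ) :
    killingTensor b (f + f') g = killingTensor b f g + killingTensor b f' g := by
  simp [killingTensor, Matrix.add_kronecker, Finset.sum_add_distrib]

lemma killingTensor_neg_left (f g : 𝔤 →ₗ[ℂ] Matrix (Fin d) (Fin d) ℂ) :
    killingTensor b (-f) g = -killingTensor b f g := by
  rw [eq_neg_iff_add_eq_zero, ← killingTensor_add_left]
  simp [killingTensor]

lemma killingTensor_sub_left (f f' g : 𝔤 →ₗ[ℂ] Matrix (Fin d) (Fin d) ℂ) :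
    killingTensor b (f - f') g = killingTensor b f g - killingTensor b f' g := by
  rw [sub_eq_add_neg, killingTensor_add_left, killingTensor_neg_left, sub_eq_add_neg]

lemma killingTensor_add_right (f g g' : 𝔤 →ₗ[ℂ] Matrix (Fin d) (Fin d) ℂ) :
    killingTensor b f (g + g') = killingTensor b f g + killingTensor b f g' := by
  simp [killingTensor, Matrix.kronecker_add, Finset.sum_add_distrib]

lemma killingTensor_neg_right (f g : 𝔤 →ₗ[ℂ] Matrix (Fin d) (Fin d) ℂ) :
    killingTensor b f (-g) = -killingTensor b f g := by
  rw [eq_neg_iff_add_eq_zero, ← killingTensor_add_right]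
  simp [killingTensor]

lemma killingTensor_sub_right (f g g' : 𝔤 →ₗ[ℂ] Matrix (Fin d) (Fin d) ℂ) :
    killingTensor b f (g - g') = killingTensor b f g - killingTensor b f g' := by
  rw [sub_eq_add_neg, killingTensor_add_right, killingTensor_neg_right, sub_eq_add_neg]

/-- Contraction of the second leg with a functional. -/
def contract (φ : Matrix (Fin d) (Fin d) ℂ →ₗ[ℂ] ℂ) (N : Matrix (Fin d × Fin d) (Fin d × Fin d) ℂ) :
    Matrix (Fin d) (Fin d) ℂ :=
  Matrix.of fun i j => φ (Matrix.of fun k l => N (i, k) (j, l))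

lemma contract_killingTensor (φ : Matrix (Fin d) (Fin d) ℂ →ₗ[ℂ] ℂ)
    (f g : 𝔤 →ₗ[ℂ] Matrix (Fin d) (Fin d) ℂ) :
    contract φ (killingTensor b f g) = ∑ i, (∑ j,
      (Matrix.of fun k l => killingForm ℂ 𝔤 (b k) (b l))⁻¹ i j * φ (g (b j))) • f (b i) := by
  ext p q
  have : (Matrix.of fun k l => killingTensor b f g (p, k) (q, l)) = ∑ i, ∑ j,
      ((Matrix.of fun k l => killingForm ℂ 𝔤 (b k) (b l))⁻¹ i j * f (b i) p q) • g (b j) := by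
    ext k l
    simp [killingTensor, Matrix.sum_apply, mul_assoc]
  simp only [contract, Matrix.of_apply, this, map_sum, map_smul, Matrix.sum_apply,
    Matrix.smul_apply, smul_eq_mul, Finset.sum_mul]
  exact Finset.sum_congr rfl fun i _ => Finset.sum_congr rfl fun j _ => by ring

lemma inv_killing_symm (i j : ι) :
    (Matrix.of fun k l => killingForm ℂ 𝔤 (b k) (b l))⁻¹ i j =
      (Matrix.of fun k l => killingForm ℂ 𝔤 (b k) (b l))⁻¹ j i := by
  have h : (Matrix.of fun k l => killingForm ℂ 𝔤 (b k) (b l)).transpose =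
      Matrix.of fun k l => killingForm ℂ 𝔤 (b k) (b l) := by
    ext k l
    exact LieModule.traceForm_comm ℂ 𝔤 𝔤 _ _
  conv_lhs => rw [← h, ← Matrix.transpose_nonsing_inv]
  rfl

variable [LieAlgebra.IsKilling ℂ 𝔤]

lemma sum_inv_killing_mul (X : 𝔤) (i : ι) :
    ∑ j, (Matrix.of fun k l => killingForm ℂ 𝔤 (b k) (b l))⁻¹ i j * killingForm ℂ 𝔤 X (b j) =
      b.repr X i := by
  set G : Matrix ι ι ℂ := Matrix.of fun k l => killingForm ℂ 𝔤 (b k) (b l) with hG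
  have hdet : IsUnit G.det := by
    have h := (LinearMap.BilinForm.nondegenerate_iff_det_ne_zero b).1
      (LieAlgebra.IsKilling.killingForm_nondegenerate ℂ 𝔤)
    rw [isUnit_iff_ne_zero]
    convert h using 2
    ext k l
    simp [hG, LinearMap.BilinForm.toMatrix_apply]
  have h1 (j : ι) : killingForm ℂ 𝔤 X (b j) = G.mulVec (b.repr X) j := by
    conv_lhs => rw [← b.sum_repr X]
    simp only [map_sum, map_smul, LinearMap.sum_apply, LinearMap.smul_apply, smul_eq_mul,
      Matrix.mulVec, dotProduct, hG, Matrix.of_apply]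
    refine Finset.sum_congr rfl fun k _ => ?_
    rw [mul_comm, LieModule.traceForm_comm]
  calc _ = (G⁻¹.mulVec (G.mulVec (b.repr X))) i := by
        simp only [h1, Matrix.mulVec, dotProduct]
    _ = b.repr X i := by
        rw [Matrix.mulVec_mulVec, Matrix.nonsing_inv_mul _ hdet, Matrix.one_mulVec]

variable {ρ : 𝔤 →ₗ[ℂ] Matrix (Fin d) (Fin d) ℂ}

/-- Pairing the second leg with `X` through the Killing form undoes the inverse matrix. This is how
tensor identities become identities of linear maps on `𝔤`. -/
lemma contract_killingTensor_right {π : Matrix (Fin d) (Fin d) ℂ →ₗ[ℂ] 𝔤}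
    (hπ : π ∘ₗ ρ = LinearMap.id) (f : 𝔤 →ₗ[ℂ] Matrix (Fin d) (Fin d) ℂ) (X : 𝔤) :
    contract (killingForm ℂ 𝔤 X ∘ₗ π) (killingTensor b f ρ) = f X := by
  have h (Y : 𝔤) : π (ρ Y) = Y := LinearMap.congr_fun hπ Y
  simp only [contract_killingTensor, LinearMap.comp_apply, h, sum_inv_killing_mul]
  conv_rhs => rw [← b.sum_repr X]
  simp only [map_sum, map_smul]

/-- A tensor `(f ⊗ ρ)(Ω)` determines `f`, if `ρ` is injective. -/
lemma killingTensor_left_injective (hρ : Function.Injective ρ)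
    {f f' : 𝔤 →ₗ[ℂ] Matrix (Fin d) (Fin d) ℂ}
    (h : killingTensor b f ρ = killingTensor b f' ρ) (X : 𝔤) : f X = f' X := by
  obtain ⟨π, hπ⟩ := ρ.exists_leftInverse_of_injective (LinearMap.ker_eq_bot.2 hρ)
  rw [← contract_killingTensor_right b hπ f, h, contract_killingTensor_right b hπ f']

/-- The same contraction of the second leg yields `f X` on one side and a combination of the `ρ (b
i)` on the other. -/
lemma mem_range_of_killingTensor_eq (hρ : Function.Injective ρ)
    {f g : 𝔤 →ₗ[ℂ] Matrix (Fin d) (Fin d) ℂ}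
    (h : killingTensor b f ρ = killingTensor b ρ g) (X : 𝔤) : f X ∈ LinearMap.range ρ := by
  obtain ⟨π, hπ⟩ := ρ.exists_leftInverse_of_injective (LinearMap.ker_eq_bot.2 hρ)
  rw [← contract_killingTensor_right b hπ f, h, contract_killingTensor]
  exact Submodule.sum_mem _ fun i _ => Submodule.smul_mem _ _ ⟨_, rfl⟩

/-- Moving an operator from one leg of the inverse form to the other replaces it by its adjoint. -/
lemma killingForm_adjoint_of_killingTensor_eq (hρ : Function.Injective ρ) {S T : 𝔤 →ₗ[ℂ] 𝔤}
    (h : killingTensor b (ρ ∘ₗ S) ρ = killingTensor b ρ (ρ ∘ₗ T)) (X Y : 𝔤) :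
    killingForm ℂ 𝔤 (S X) Y = killingForm ℂ 𝔤 X (T Y) := by
  obtain ⟨π, hπ⟩ := ρ.exists_leftInverse_of_injective (LinearMap.ker_eq_bot.2 hρ)
  have hπ' (Y : 𝔤) : π (ρ Y) = Y := LinearMap.congr_fun hπ Y
  have h1 := contract_killingTensor_right b hπ (ρ ∘ₗ S) X
  rw [h, contract_killingTensor] at h1
  replace h1 := congrArg π h1
  simp only [LinearMap.comp_apply, map_sum, map_smul, hπ'] at h1
  rw [← h1, LieModule.traceForm_comm]
  simp only [map_sum, map_smul, smul_eq_mul]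
  calc _ = ∑ i, ∑ j, (Matrix.of fun k l => killingForm ℂ 𝔤 (b k) (b l))⁻¹ i j *
          killingForm ℂ 𝔤 Y (b i) * killingForm ℂ 𝔤 X (T (b j)) := by
        refine Finset.sum_congr rfl fun i _ => ?_
        rw [Finset.sum_mul]
        exact Finset.sum_congr rfl fun j _ => by ring
    _ = killingForm ℂ 𝔤 X (T Y) := by
        rw [Finset.sum_comm]
        simp only [← Finset.sum_mul, inv_killing_symm b _, sum_inv_killing_mul]
        conv_rhs => rw [← b.sum_repr Y]
        simp only [map_sum, map_smul, smul_eq_mul]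

end KillingTensor

/-! ### Leading coefficients at infinity -/

section Limits

/-- The leading order of an identity `(v + c) A(v) + (v - c) B(v) = 0` at infinity. -/
lemma add_eq_zero_of_tendsto_cobounded {n : Type*} [Fintype n] {F : Filter ℂ} [F.NeBot]
    (hF : F ≤ Bornology.cobounded ℂ) {A B : ℂ → Matrix n n ℂ} {A₀ B₀ : Matrix n n ℂ}
    (hA : Tendsto A F (𝓝 A₀)) (hB : Tendsto B F (𝓝 B₀)) (c : ℂ)
    (h : ∀ᶠ v in F, (v + c) • A v + (v - c) • B v = 0) : A₀ + B₀ = 0 := by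
  have hinv : Tendsto (fun v : ℂ => v⁻¹) F (𝓝 0) := tendsto_inv₀_cobounded.mono_left hF
  have hc : Tendsto (fun v : ℂ => c * v⁻¹) F (𝓝 0) := by simpa using hinv.const_mul c
  have h1 : Tendsto (fun v => (1 + c * v⁻¹) • A v + (1 - c * v⁻¹) • B v) F (𝓝 (A₀ + B₀)) := by
    simpa using ((hc.const_add 1).smul hA).add ((hc.const_sub 1).smul hB)
  refine tendsto_nhds_unique (h1.congr' ?_) tendsto_const_nhds
  have hne : ∀ᶠ v : ℂ in F, v ≠ 0 := hF (Bornology.eventually_ne_cobounded 0)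
  filter_upwards [h, hne] with v hv hv0
  have : (1 + c * v⁻¹) • A v + (1 - c * v⁻¹) • B v
      = v⁻¹ • ((v + c) • A v + (v - c) • B v) := by
    rw [smul_add, smul_smul, smul_smul]
    congr 2 <;> field_simp
  rw [this, hv, smul_zero]

end Limits

/-! ### Expansion of the equation at infinity -/

section Equation

lemma tendsto_leg1_one {d : ℕ} {F : Filter ℂ} {k : ℂ → Matrix (Fin d) (Fin d) ℂ}
    (hk : Tendsto k F (𝓝 1)) : Tendsto (fun v => leg1 (k v)) F (𝓝 1) := by
  have h := (continuous_leg1.tendsto (1 : Matrix (Fin d) (Fin d) ℂ)).comp hk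
  rwa [leg1_one] at h

lemma tendsto_leg2_one {d : ℕ} {F : Filter ℂ} {k : ℂ → Matrix (Fin d) (Fin d) ℂ}
    (hk : Tendsto k F (𝓝 1)) : Tendsto (fun v => leg2 (k v)) F (𝓝 1) := by
  have h := (continuous_leg2.tendsto (1 : Matrix (Fin d) (Fin d) ℂ)).comp hk
  rwa [leg2_one] at h

variable {d : ℕ} {D : Set ℂ} (hD : D ∈ Bornology.cobounded ℂ)
  {k : ℂ → Matrix (Fin d) (Fin d) ℂ} {C₁₁ C₂₂ C₂₁ C₁₂ : Matrix (Fin d × Fin d) (Fin d × Fin d) ℂ}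
include hD

/-- The equation with denominators cleared. -/
def ClearedEquation (D : Set ℂ) (k : ℂ → Matrix (Fin d) (Fin d) ℂ)
    (C₁₁ C₂₂ C₂₁ C₁₂ : Matrix (Fin d × Fin d) (Fin d × Fin d) ℂ) : Prop :=
  ∀ u ∈ D, ∀ v ∈ D, u ≠ v → u ≠ -v →
    (u + v) • (C₁₁ * leg1 (k u) * leg2 (k v) - leg1 (k u) * leg2 (k v) * C₂₂)
      + (u - v) • (leg1 (k u) * C₂₁ * leg2 (k v) - leg2 (k v) * C₁₂ * leg1 (k u)) = 0

/-- The coefficient of `v` as `v → ∞` with `u` fixed, where `leg2 (k v)` becomes `1`. -/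
lemma first_order_leg1 (hk : ClearedEquation D k C₁₁ C₂₂ C₂₁ C₁₂)
    (hlim : Tendsto k (Bornology.cobounded ℂ) (𝓝 1)) {u : ℂ} (hu : u ∈ D) :
    C₁₁ * leg1 (k u) - leg1 (k u) * C₂₂ - (leg1 (k u) * C₂₁ - C₁₂ * leg1 (k u)) = 0 := by
  have h2 := tendsto_leg2_one hlim
  rw [sub_eq_add_neg]
  refine add_eq_zero_of_tendsto_cobounded le_rfl
    (A := fun v => C₁₁ * leg1 (k u) * leg2 (k v) - leg1 (k u) * leg2 (k v) * C₂₂)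
    (B := fun v => -(leg1 (k u) * C₂₁ * leg2 (k v) - leg2 (k v) * C₁₂ * leg1 (k u)))
    (by
      simpa using (h2.const_mul (C₁₁ * leg1 (k u))).sub
        ((h2.const_mul (leg1 (k u))).mul_const C₂₂))
    (by
      simpa using ((h2.const_mul (leg1 (k u) * C₂₁)).sub
        ((h2.mul_const C₁₂).mul_const (leg1 (k u)))).neg) u ?_
  filter_upwards [hD, Bornology.eventually_ne_cobounded u, Bornology.eventually_ne_cobounded (-u)] with v hv hv1 hv2
  have := hk u hu v hv hv1.symm (fun h => hv2 (by rw [h, neg_neg]))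
  rw [← this]
  module

lemma first_order_leg2 (hk : ClearedEquation D k C₁₁ C₂₂ C₂₁ C₁₂)
    (hlim : Tendsto k (Bornology.cobounded ℂ) (𝓝 1)) {v : ℂ} (hv : v ∈ D) :
    C₁₁ * leg2 (k v) - leg2 (k v) * C₂₂ + (C₂₁ * leg2 (k v) - leg2 (k v) * C₁₂) = 0 := by
  have h1 := tendsto_leg1_one hlim
  refine add_eq_zero_of_tendsto_cobounded le_rfl
    (A := fun u => C₁₁ * leg1 (k u) * leg2 (k v) - leg1 (k u) * leg2 (k v) * C₂₂)
    (B := fun u => leg1 (k u) * C₂₁ * leg2 (k v) - leg2 (k v) * C₁₂ * leg1 (k u))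
    (by
      simpa using ((h1.const_mul C₁₁).mul_const (leg2 (k v))).sub
        ((h1.mul_const (leg2 (k v))).mul_const C₂₂))
    (by
      simpa using ((h1.mul_const C₂₁).mul_const (leg2 (k v))).sub
        (h1.const_mul (leg2 (k v) * C₁₂))) v ?_
  filter_upwards [hD, Bornology.eventually_ne_cobounded v, Bornology.eventually_ne_cobounded (-v)] with u hu hu1 hu2
  exact hk u hu v hv hu1 hu2

/-- Sending the remaining parameter to infinity in the two first-order identities gives both the
difference and the sum of `C₁₁ - C₂₂` and `C₂₁ - C₁₂`. -/
lemma leading_order (hk : ClearedEquation D k C₁₁ C₂₂ C₂₁ C₁₂)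
    (hlim : Tendsto k (Bornology.cobounded ℂ) (𝓝 1)) : C₁₁ = C₂₂ ∧ C₂₁ = C₁₂ := by
  have h1 := tendsto_leg1_one hlim
  have h2 := tendsto_leg2_one hlim
  have e1 : C₁₁ - C₂₂ - (C₂₁ - C₁₂) = 0 := by
    have : Tendsto (fun u => C₁₁ * leg1 (k u) - leg1 (k u) * C₂₂
        - (leg1 (k u) * C₂₁ - C₁₂ * leg1 (k u))) (Bornology.cobounded ℂ)
        (𝓝 (C₁₁ - C₂₂ - (C₂₁ - C₁₂))) := by
      simpa using ((h1.const_mul C₁₁).sub (h1.mul_const C₂₂)).sub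
        ((h1.mul_const C₂₁).sub (h1.const_mul C₁₂))
    refine tendsto_nhds_unique (this.congr' ?_) tendsto_const_nhds
    filter_upwards [hD] with u hu using first_order_leg1 hD hk hlim hu
  have e2 : C₁₁ - C₂₂ + (C₂₁ - C₁₂) = 0 := by
    have : Tendsto (fun u => C₁₁ * leg2 (k u) - leg2 (k u) * C₂₂
        + (C₂₁ * leg2 (k u) - leg2 (k u) * C₁₂)) (Bornology.cobounded ℂ)
        (𝓝 (C₁₁ - C₂₂ + (C₂₁ - C₁₂))) := by
      simpa using ((h2.const_mul C₁₁).sub (h2.mul_const C₂₂)).add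
        ((h2.const_mul C₂₁).sub (h2.mul_const C₁₂))
    refine tendsto_nhds_unique (this.congr' ?_) tendsto_const_nhds
    filter_upwards [hD] with u hu using first_order_leg2 hD hk hlim hu
  constructor
  · have h : (2 : ℂ) • (C₁₁ - C₂₂) = 0 := by
      rw [← add_zero (0 : Matrix (Fin d × Fin d) (Fin d × Fin d) ℂ)]
      nth_rewrite 1 [← e1]
      rw [← e2]
      module
    exact sub_eq_zero.1 ((smul_eq_zero.1 h).resolve_left two_ne_zero)
  · have h : (2 : ℂ) • (C₂₁ - C₁₂) = 0 := by
      rw [← sub_zero (0 : Matrix (Fin d × Fin d) (Fin d × Fin d) ℂ)]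
      nth_rewrite 1 [← e2]
      rw [← e1]
      module
    exact sub_eq_zero.1 ((smul_eq_zero.1 h).resolve_left two_ne_zero)

variable {C C' : Matrix (Fin d × Fin d) (Fin d × Fin d) ℂ} (hk : ClearedEquation D k C C C' C')
  (hlim : Tendsto k (Bornology.cobounded ℂ) (𝓝 1))
include hk hlim

lemma commute_add_leg1 {u : ℂ} (hu : u ∈ D) : Commute (C + C') (leg1 (k u)) := by
  have := first_order_leg1 hD hk hlim hu
  rw [commute_iff_eq, ← sub_eq_zero, ← this]
  noncomm_ring

lemma commute_add_leg2 {u : ℂ} (hu : u ∈ D) : Commute (C + C') (leg2 (k u)) := by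
  have := first_order_leg2 hD hk hlim hu
  rw [commute_iff_eq, ← sub_eq_zero, ← this]
  noncomm_ring

variable {F : Filter ℂ} [F.NeBot] (hF : F ≤ Bornology.cobounded ℂ)
  {x : Matrix (Fin d) (Fin d) ℂ} (hx : Tendsto (fun v => v • (k v - 1)) F (𝓝 x))
include hF hx

lemma commute_add_leg1_limit : Commute (C + C') (leg1 x) := by
  have h1 : Tendsto (fun v => leg1 (v • (k v - 1))) F (𝓝 (leg1 x)) :=
    (continuous_leg1.tendsto x).comp hx
  refine tendsto_nhds_unique (h1.const_mul (C + C')) ((h1.mul_const (C + C')).congr' ?_)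
  filter_upwards [hF hD] with v hv
  have := commute_add_leg1 hD hk hlim hv
  simp only [leg1_smul, leg1_sub, leg1_one]
  exact (((this.sub_right (Commute.one_right _)).smul_right v).eq).symm

/-- The second order of the equation in the second spectral parameter. -/
lemma second_order {u : ℂ} (hu : u ∈ D) :
    (2 * u) • ((C - C') * leg1 (k u) - leg1 (k u) * (C - C')) =
      leg2 x * ((C - C') * leg1 (k u) + leg1 (k u) * (C - C'))
        - ((C - C') * leg1 (k u) + leg1 (k u) * (C - C')) * leg2 x := by
  set Q := C - C' with hQ
  set P := C + C' with hP
  set K := leg1 (k u) with hK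
  have hinv : Tendsto (fun v : ℂ => u * v⁻¹) F (𝓝 0) := by
    simpa using (tendsto_inv₀_cobounded.mono_left hF).const_mul u
  have h2 : Tendsto (fun v => leg2 (v • (k v - 1))) F (𝓝 (leg2 x)) :=
    (continuous_leg2.tendsto x).comp hx
  have hc : Tendsto (fun v : ℂ => 1 + u * v⁻¹) F (𝓝 1) := by simpa using hinv.const_add 1
  have hc' : Tendsto (fun v : ℂ => 1 - u * v⁻¹) F (𝓝 1) := by simpa using hinv.const_sub 1
  -- With `leg2 (k v) = 1 + v⁻¹ * leg2 (v • (k v - 1))` the terms of order `v` cancel. The function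
  -- whose limit is taken here is exactly what remains, and it is zero for every admissible `v`.
  have hT := ((hc.smul ((h2.const_mul (Q * K)).sub (h2.mul_const (K * Q)))).add
    (hc'.smul ((h2.const_mul (K * Q)).sub (h2.mul_const (Q * K))))).const_add
      ((2 * u) • (Q * K - K * Q))
  have h0 := tendsto_nhds_unique (hT.congr' (f₂ := fun _ => 0) ?_) tendsto_const_nhds
  · rw [← sub_eq_zero, ← h0]
    simp only [one_smul, mul_add, add_mul]
    abel
  filter_upwards [hF hD, hF (Bornology.eventually_ne_cobounded 0),
    hF (Bornology.eventually_ne_cobounded u), hF (Bornology.eventually_ne_cobounded (-u))]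
    with v hv hv0 hv1 hv2
  have hE := hk u hu v hv hv1.symm (fun h => hv2 (by rw [h, neg_neg]))
  have c1 : Commute P K := commute_add_leg1 hD hk hlim hu
  have c2 : Commute P (leg2 (k v)) := commute_add_leg2 hD hk hlim hv
  have c3 : Commute K (leg2 (k v)) := leg1_commute_leg2 _ _
  simp only [leg2_smul, leg2_sub, leg2_one]
  rw [← hK] at hE
  generalize leg2 (k v) = L at *
  -- Substitute `2C = P + Q` and `2C' = P - Q`; the `P` terms cancel because `P` commutes with `K`
  -- and `L`.
  have a1 : (2 : ℂ) • (C * K * L - K * L * C) = Q * K * L - L * (K * Q) := by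
    have h := (c1.mul_right c2).eq
    rw [← mul_assoc L, ← c3.eq, ← sub_eq_zero, ← sub_eq_zero.2 h, hP, hQ, two_smul]
    noncomm_ring
  have a2 : (2 : ℂ) • (K * C' * L - L * C' * K) = -(K * Q * L - L * (Q * K)) := by
    have h : K * P * L = L * P * K := by
      rw [← c1.eq, ← c2.eq, mul_assoc, mul_assoc, c3.eq]
    rw [← sub_eq_zero, ← sub_eq_zero.2 h, hP, hQ, two_smul]
    noncomm_ring
  have a3 : (u + v) • (Q * K * L - L * (K * Q)) + (u - v) • -(K * Q * L - L * (Q * K)) = 0 := by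
    rw [← a1, ← a2, smul_comm, smul_comm (u - v), ← smul_add, hE, smul_zero]
  rw [← a3]
  simp only [mul_smul_comm, smul_mul_assoc, mul_sub, sub_mul, mul_one, one_mul]
  match_scalars <;> field_simp <;> ring

end Equation

/-! ### Limit points of the `1/u` coefficient, and Schur's lemma -/

section Limit

variable {d : ℕ}

/-- The leading order of `second_order` in the first spectral parameter. -/
lemma commute_sub_leg_limit {D : Set ℂ} (hD : D ∈ Bornology.cobounded ℂ)
    {k : ℂ → Matrix (Fin d) (Fin d) ℂ} {C C' : Matrix (Fin d × Fin d) (Fin d × Fin d) ℂ}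
    (hk : ClearedEquation D k C C C' C') (hlim : Tendsto k (Bornology.cobounded ℂ) (𝓝 1))
    {F : Filter ℂ} [F.NeBot] (hF : F ≤ Bornology.cobounded ℂ)
    {x : Matrix (Fin d) (Fin d) ℂ} (hx : Tendsto (fun v => v • (k v - 1)) F (𝓝 x)) :
    Commute (C - C') (leg1 x + leg2 x) := by
  have h1 : Tendsto (fun v => leg1 (v • (k v - 1))) F (𝓝 (leg1 x)) :=
    (continuous_leg1.tendsto x).comp hx
  have hK := tendsto_leg1_one (hlim.mono_left hF)
  set Q := C - C' with hQ
  have hS := (hK.const_mul Q).add (hK.mul_const Q)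
  have hL := ((h1.const_mul Q).sub (h1.mul_const Q)).const_smul (2 : ℂ)
  have hR := (hS.const_mul (leg2 x)).sub (hS.mul_const (leg2 x))
  -- Take the parameter `u` of `second_order` to infinity along the same filter: the factor `2u`
  -- turns `k u` into `2x` inside the commutator, and the anticommutator tends to `2Q`.
  have h := tendsto_nhds_unique (hL.congr' ?_) hR
  · have h2 : (2 : ℂ) • (Q * (leg1 x + leg2 x) - (leg1 x + leg2 x) * Q) = 0 := by
      rw [← sub_eq_zero] at h
      rw [← h]
      simp only [mul_one, one_mul, mul_add, add_mul]
      module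
    exact sub_eq_zero.1 ((smul_eq_zero.1 h2).resolve_left two_ne_zero)
  filter_upwards [hF hD] with v hv
  have hE := second_order hD hk hlim hF hx hv
  rw [← hQ] at hE
  rw [← hE, leg1_smul, leg1_sub, leg1_one]
  simp only [mul_smul_comm, smul_mul_assoc, mul_sub, sub_mul, mul_one, one_mul]
  module

/-- A function that is `O(1)` at infinity has a limit along some filter going to infinity. -/
lemma exists_tendsto_of_isBigO_one {m n : Type*} [Finite m] [Finite n] {f : ℂ → Matrix m n ℂ}
    (hf : ∀ i j, (fun u => f u i j) =O[Bornology.cobounded ℂ] fun _ => (1 : ℂ)) :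
    ∃ F : Filter ℂ, F.NeBot ∧ F ≤ Bornology.cobounded ℂ ∧ ∃ x, Tendsto f F (𝓝 x) := by
  have : Fintype m := Fintype.ofFinite m
  have : Fintype n := Fintype.ofFinite n
  choose c hc using fun i j => (hf i j).bound
  have hS : IsCompact (Set.univ.pi fun i => Set.univ.pi fun j =>
      Metric.closedBall (0 : ℂ) (c i j) : Set (Matrix m n ℂ)) :=
    isCompact_univ_pi fun i => isCompact_univ_pi fun j => isCompact_closedBall _ _
  let F : Ultrafilter ℂ := Ultrafilter.of (Bornology.cobounded ℂ)
  have hF : (F : Filter ℂ) ≤ Bornology.cobounded ℂ := Ultrafilter.of_le _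
  obtain ⟨x, -, hx⟩ := hS.ultrafilter_le_nhds (F.map f) (by
    rw [Filter.le_principal_iff]
    have h : ∀ᶠ u in (F : Filter ℂ), ∀ i j, ‖f u i j‖ ≤ c i j * ‖(1 : ℂ)‖ :=
      hF (eventually_all.2 fun i => eventually_all.2 fun j => hc i j)
    change ∀ᶠ u in (F : Filter ℂ), f u ∈ _
    filter_upwards [h] with u hu
    intro i _ j _
    simpa using hu i j)
  exact ⟨F, inferInstance, hF, x, hx⟩

/-- Schur's lemma. -/
lemma IsIrreducibleRep.exists_eq_smul_one {𝔤 : Type*} [LieRing 𝔤] [LieAlgebra ℂ 𝔤]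
    {ρ : 𝔤 →ₗ⁅ℂ⁆ Matrix (Fin d) (Fin d) ℂ} (hρ : IsIrreducibleRep ρ)
    {T : Matrix (Fin d) (Fin d) ℂ} (hT : ∀ X, Commute (ρ X) T) : ∃ c : ℂ, T = c • 1 := by
  obtain ⟨hd, hW⟩ := hρ
  have : NeZero d := ⟨hd⟩
  obtain ⟨c, hc⟩ := Module.End.exists_eigenvalue (Matrix.toLin' T)
  refine ⟨c, ?_⟩
  have htop := (hW (Module.End.eigenspace (Matrix.toLin' T) c) ?_).resolve_left hc
  · apply Matrix.toLin'.injective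
    ext1 i
    ext1
    have h : Pi.single i 1 ∈ Module.End.eigenspace (Matrix.toLin' T) c := htop ▸ Submodule.mem_top
    rw [Module.End.mem_eigenspace_iff] at h
    funext j
    simpa using congrFun h j
  · intro X w hw
    rw [Module.End.mem_eigenspace_iff, Matrix.toLin'_apply] at hw ⊢
    rw [Matrix.mulVec_mulVec, ← (hT X).eq, ← Matrix.mulVec_mulVec, hw, Matrix.mulVec_smul]

end Limit

/-! ### The involution, and the derivation induced by the `1/u` coefficient -/

section Algebra

variable {𝔤 : Type*} [LieRing 𝔤] [LieAlgebra ℂ 𝔤] {ι : Type*} [Fintype ι] [DecidableEq ι]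
  (b : Basis ι ℂ 𝔤) {d : ℕ}

/-- The representation `X ↦ κ ρ(X) κ⁻¹`. -/
noncomputable def conjRep (κ : Matrix (Fin d) (Fin d) ℂ) (hκ : IsUnit κ)
    (ρ : 𝔤 →ₗ⁅ℂ⁆ Matrix (Fin d) (Fin d) ℂ) : 𝔤 →ₗ⁅ℂ⁆ Matrix (Fin d) (Fin d) ℂ where
  toLinearMap := LinearMap.mulRight ℂ κ⁻¹ ∘ₗ LinearMap.mulLeft ℂ κ ∘ₗ (ρ : 𝔤 →ₗ[ℂ] Matrix (Fin d) (Fin d) ℂ)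
  map_lie' := by
    intro X Y
    have h : κ⁻¹ * κ = 1 := Matrix.nonsing_inv_mul _ ((Matrix.isUnit_iff_isUnit_det κ).1 hκ)
    have h' (A B : Matrix (Fin d) (Fin d) ℂ) : κ * A * κ⁻¹ * (κ * B * κ⁻¹) = κ * (A * B) * κ⁻¹ := by
      calc _ = κ * A * (κ⁻¹ * κ) * B * κ⁻¹ := by simp only [mul_assoc]
        _ = _ := by rw [h]; simp only [mul_assoc, one_mul]
    simp [LieRing.of_associative_ring_bracket, h', mul_sub, sub_mul]

lemma conjRep_apply (κ : Matrix (Fin d) (Fin d) ℂ) (hκ : IsUnit κ)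
    (ρ : 𝔤 →ₗ⁅ℂ⁆ Matrix (Fin d) (Fin d) ℂ) (X : 𝔤) : conjRep κ hκ ρ X = κ * ρ X * κ⁻¹ := rfl

lemma conjRep_injective {κ : Matrix (Fin d) (Fin d) ℂ} (hκ : IsUnit κ)
    {ρ : 𝔤 →ₗ⁅ℂ⁆ Matrix (Fin d) (Fin d) ℂ} (hρ : Function.Injective ρ) :
    Function.Injective (conjRep κ hκ ρ) := by
  intro X Y h
  have hu : IsUnit κ⁻¹ := Matrix.isUnit_nonsing_inv_iff.2 hκ
  rw [conjRep_apply, conjRep_apply] at h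
  exact hρ (hκ.mul_left_cancel (hu.mul_right_cancel h))

lemma IsSolutionOn.clearedEquation {ρ₁ ρ₂ : 𝔤 →ₗ⁅ℂ⁆ Matrix (Fin d) (Fin d) ℂ}
    {κt : ℂ → Matrix (Fin d) (Fin d) ℂ} {D : Set ℂ} (h : IsSolutionOn b ρ₁ ρ₂ κt D)
    {κ : Matrix (Fin d) (Fin d) ℂ} (hκ : IsUnit κ) :
    ClearedEquation D (fun u => κt u * κ⁻¹)
      (killingTensor b (ρ₁ : 𝔤 →ₗ[ℂ] Matrix (Fin d) (Fin d) ℂ) (ρ₁ : 𝔤 →ₗ[ℂ] Matrix (Fin d) (Fin d) ℂ))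
      (killingTensor b (conjRep κ hκ ρ₂ : 𝔤 →ₗ[ℂ] Matrix (Fin d) (Fin d) ℂ)
        (conjRep κ hκ ρ₂ : 𝔤 →ₗ[ℂ] Matrix (Fin d) (Fin d) ℂ))
      (killingTensor b (conjRep κ hκ ρ₂ : 𝔤 →ₗ[ℂ] Matrix (Fin d) (Fin d) ℂ) (ρ₁ : 𝔤 →ₗ[ℂ] Matrix (Fin d) (Fin d) ℂ))
      (killingTensor b (ρ₁ : 𝔤 →ₗ[ℂ] Matrix (Fin d) (Fin d) ℂ) (conjRep κ hκ ρ₂ : 𝔤 →ₗ[ℂ] Matrix (Fin d) (Fin d) ℂ)) := by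
  intro u hu v hv huv huv'
  have hE := h u hu v hv huv huv'
  rw [Equation] at hE
  have h1 : u - v ≠ 0 := sub_ne_zero.2 huv
  have h2 : u + v ≠ 0 := fun h => huv' (eq_neg_of_add_eq_zero_left h)
  simp only [casimir_eq_killingTensor] at hE
  have hE' : (u + v) • (killingTensor b (ρ₁ : 𝔤 →ₗ[ℂ] Matrix (Fin d) (Fin d) ℂ) (ρ₁ : 𝔤 →ₗ[ℂ] Matrix (Fin d) (Fin d) ℂ) * leg1 (κt u) * leg2 (κt v)
      - leg1 (κt u) * leg2 (κt v) * killingTensor b (ρ₂ : 𝔤 →ₗ[ℂ] Matrix (Fin d) (Fin d) ℂ) (ρ₂ : 𝔤 →ₗ[ℂ] Matrix (Fin d) (Fin d) ℂ))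
      + (u - v) • (leg1 (κt u) * killingTensor b (ρ₂ : 𝔤 →ₗ[ℂ] Matrix (Fin d) (Fin d) ℂ) (ρ₁ : 𝔤 →ₗ[ℂ] Matrix (Fin d) (Fin d) ℂ) * leg2 (κt v)
      - leg2 (κt v) * killingTensor b (ρ₁ : 𝔤 →ₗ[ℂ] Matrix (Fin d) (Fin d) ℂ) (ρ₂ : 𝔤 →ₗ[ℂ] Matrix (Fin d) (Fin d) ℂ) * leg1 (κt u)) = 0 := by
    rw [← smul_zero ((u - v) * (u + v)), ← hE, smul_add, smul_smul, smul_smul]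
    congr 2 <;> field_simp
  have hκ' : κ⁻¹ * κ = 1 := Matrix.nonsing_inv_mul _ ((Matrix.isUnit_iff_isUnit_det κ).1 hκ)
  have e1 : leg1 κ⁻¹ * leg1 κ = 1 := by rw [← leg1_mul, hκ', leg1_one]
  have e2 : leg2 κ⁻¹ * leg2 κ = 1 := by rw [← leg2_mul, hκ', leg2_one]
  have hl (f : 𝔤 →ₗ[ℂ] Matrix (Fin d) (Fin d) ℂ) :
      killingTensor b (conjRep κ hκ ρ₂ : 𝔤 →ₗ[ℂ] Matrix (Fin d) (Fin d) ℂ) f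
        = leg1 κ * killingTensor b (ρ₂ : 𝔤 →ₗ[ℂ] Matrix (Fin d) (Fin d) ℂ) f * leg1 κ⁻¹ := by
    rw [leg1_mul_killingTensor, killingTensor_mul_leg1]; rfl
  have hr (f : 𝔤 →ₗ[ℂ] Matrix (Fin d) (Fin d) ℂ) :
      killingTensor b f (conjRep κ hκ ρ₂ : 𝔤 →ₗ[ℂ] Matrix (Fin d) (Fin d) ℂ)
        = leg2 κ * killingTensor b f (ρ₂ : 𝔤 →ₗ[ℂ] Matrix (Fin d) (Fin d) ℂ) * leg2 κ⁻¹ := by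
    rw [leg2_mul_killingTensor, killingTensor_mul_leg2]; rfl
  have hc (S T : Matrix (Fin d) (Fin d) ℂ) : leg2 T * leg1 S = leg1 S * leg2 T :=
    (leg1_commute_leg2 S T).eq.symm
  rw [hl, hl, hr, hr]
  generalize killingTensor b (ρ₁ : 𝔤 →ₗ[ℂ] Matrix (Fin d) (Fin d) ℂ) (ρ₁ : 𝔤 →ₗ[ℂ] Matrix (Fin d) (Fin d) ℂ) = C₁₁ at *
  generalize killingTensor b (ρ₂ : 𝔤 →ₗ[ℂ] Matrix (Fin d) (Fin d) ℂ) (ρ₂ : 𝔤 →ₗ[ℂ] Matrix (Fin d) (Fin d) ℂ) = C₂₂ at *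
  generalize killingTensor b (ρ₂ : 𝔤 →ₗ[ℂ] Matrix (Fin d) (Fin d) ℂ) (ρ₁ : 𝔤 →ₗ[ℂ] Matrix (Fin d) (Fin d) ℂ) = C₂₁ at *
  generalize killingTensor b (ρ₁ : 𝔤 →ₗ[ℂ] Matrix (Fin d) (Fin d) ℂ) (ρ₂ : 𝔤 →ₗ[ℂ] Matrix (Fin d) (Fin d) ℂ) = C₁₂ at *
  simp only [leg1_mul, leg2_mul]
  have e1' (A : Matrix (Fin d × Fin d) (Fin d × Fin d) ℂ) : leg1 κ⁻¹ * (leg1 κ * A) = A := by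
    rw [← mul_assoc, e1, one_mul]
  have e2' (A : Matrix (Fin d × Fin d) (Fin d × Fin d) ℂ) : leg2 κ⁻¹ * (leg2 κ * A) = A := by
    rw [← mul_assoc, e2, one_mul]
  have hc' (S T : Matrix (Fin d) (Fin d) ℂ) (A : Matrix (Fin d × Fin d) (Fin d × Fin d) ℂ) :
      leg2 T * (leg1 S * A) = leg1 S * (leg2 T * A) := by
    rw [← mul_assoc, hc, mul_assoc]
  have key := congrArg (· * (leg1 κ⁻¹ * leg2 κ⁻¹)) hE'
  simp only [zero_mul] at key
  rw [← key]
  simp only [add_mul, sub_mul, smul_mul_assoc, mul_assoc, hc, hc', e1', e2']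

variable {b} [LieAlgebra.IsKilling ℂ 𝔤]

lemma commute_of_commute_killingTensor {ρ : 𝔤 →ₗ[ℂ] Matrix (Fin d) (Fin d) ℂ}
    (hρ : Function.Injective ρ) {f : 𝔤 →ₗ[ℂ] Matrix (Fin d) (Fin d) ℂ}
    {T : Matrix (Fin d) (Fin d) ℂ} (h : Commute (killingTensor b f ρ) (leg1 T)) (X : 𝔤) :
    Commute (f X) T := by
  have h' := h.eq
  rw [leg1_mul_killingTensor, killingTensor_mul_leg1] at h'
  exact killingTensor_left_injective b hρ h' X

lemma killingForm_left_injective {X Y : 𝔤}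
    (h : ∀ Z, killingForm ℂ 𝔤 X Z = killingForm ℂ 𝔤 Y Z) : X = Y := by
  have hk := LieAlgebra.IsKilling.ker_killingForm_eq_bot ℂ 𝔤
  exact LinearMap.ker_eq_bot.1 hk (LinearMap.ext h)

variable [FiniteDimensional ℂ 𝔤]

lemma exists_involution {ρ σ : 𝔤 →ₗ⁅ℂ⁆ Matrix (Fin d) (Fin d) ℂ}
    (hρ : Function.Injective ρ) (hσ : Function.Injective σ)
    (h : killingTensor b (σ : 𝔤 →ₗ[ℂ] Matrix (Fin d) (Fin d) ℂ) (ρ : 𝔤 →ₗ[ℂ] Matrix (Fin d) (Fin d) ℂ)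
      = killingTensor b (ρ : 𝔤 →ₗ[ℂ] Matrix (Fin d) (Fin d) ℂ) (σ : 𝔤 →ₗ[ℂ] Matrix (Fin d) (Fin d) ℂ)) :
    ∃ α : 𝔤 ≃ₗ⁅ℂ⁆ 𝔤, (∀ X, ρ (α X) = σ X) ∧ (∀ X, α (α X) = X) ∧
      ∀ X Y, killingForm ℂ 𝔤 (α X) Y = killingForm ℂ 𝔤 X (α Y) := by
  obtain ⟨π, hπ⟩ := (ρ : 𝔤 →ₗ[ℂ] Matrix (Fin d) (Fin d) ℂ).exists_leftInverse_of_injective (LinearMap.ker_eq_bot.2 hρ)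
  have hρπ (X : 𝔤) : ρ (π (σ X)) = σ X := by
    obtain ⟨Y, hY⟩ := mem_range_of_killingTensor_eq b (ρ := (ρ : 𝔤 →ₗ[ℂ] Matrix (Fin d) (Fin d) ℂ)) hρ h X
    have hY' : ρ Y = σ X := hY
    rw [← hY']
    exact congrArg ρ (LinearMap.congr_fun hπ Y)
  let f : 𝔤 →ₗ⁅ℂ⁆ 𝔤 :=
    { π ∘ₗ (σ : 𝔤 →ₗ[ℂ] Matrix (Fin d) (Fin d) ℂ) with
      map_lie' := by
        intro X Y
        apply hρ
        change ρ (π (σ ⁅X, Y⁆)) = ρ ⁅π (σ X), π (σ Y)⁆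
        rw [hρπ, LieHom.map_lie, LieHom.map_lie, hρπ, hρπ] }
  have hf (X : 𝔤) : ρ (f X) = σ X := hρπ X
  have hinj : Function.Injective f := fun X Y hXY => hσ (by rw [← hf, ← hf, hXY])
  let α : 𝔤 ≃ₗ⁅ℂ⁆ 𝔤 := LieEquiv.ofBijective f
    ⟨hinj, (LinearMap.injective_iff_surjective (f := (f : 𝔤 →ₗ[ℂ] 𝔤))).1 hinj⟩
  have hα (X : 𝔤) : ρ (α X) = σ X := hf X
  have hadj (X Y : 𝔤) : killingForm ℂ 𝔤 (α X) Y = killingForm ℂ 𝔤 X (α Y) := by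
    have e : (σ : 𝔤 →ₗ[ℂ] Matrix (Fin d) (Fin d) ℂ) = (ρ : 𝔤 →ₗ[ℂ] Matrix (Fin d) (Fin d) ℂ) ∘ₗ (f : 𝔤 →ₗ[ℂ] 𝔤) :=
      LinearMap.ext fun X => (hf X).symm
    rw [e] at h
    exact killingForm_adjoint_of_killingTensor_eq b (ρ := (ρ : 𝔤 →ₗ[ℂ] Matrix (Fin d) (Fin d) ℂ)) hρ h X Y
  -- Self-adjointness and invariance of the Killing form under automorphisms make `α²` act trivially
  -- in every pairing.
  refine ⟨α, hα, fun X => killingForm_left_injective fun Y => ?_, hadj⟩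
  rw [hadj, LieAlgebra.killingForm_of_equiv_apply]

/-- Here the hypothesis on `𝔥` enters, and only through its trivial centre. The tensor `Q` has two
expressions, so its commutator with `leg1 x + leg2 x` compares `ad x` acting on either leg. -/
lemma commute_of_killingTensor_symmetric {ρ : 𝔤 →ₗ⁅ℂ⁆ Matrix (Fin d) (Fin d) ℂ}
    (hρ : Function.Injective ρ) {α : 𝔤 ≃ₗ⁅ℂ⁆ 𝔤} (hα : ∀ X, α (α X) = X)
    (hadj : ∀ X Y, killingForm ℂ 𝔤 (α X) Y = killingForm ℂ 𝔤 X (α Y))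
    (hcenter : LieAlgebra.center ℂ (invariantSubalgebra α) = ⊥)
    {x : Matrix (Fin d) (Fin d) ℂ} (hx : ∀ X, Commute (ρ (X + α X)) x)
    {m : 𝔤 →ₗ[ℂ] Matrix (Fin d) (Fin d) ℂ} (hm : ∀ X, m X = ρ (X - α X))
    {Q : Matrix (Fin d × Fin d) (Fin d × Fin d) ℂ}
    (hQ : Q = killingTensor b m (ρ : 𝔤 →ₗ[ℂ] Matrix (Fin d) (Fin d) ℂ)) (hQ' : Q = killingTensor b (ρ : 𝔤 →ₗ[ℂ] Matrix (Fin d) (Fin d) ℂ) m)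
    (hc : Commute Q (leg1 x + leg2 x)) (X : 𝔤) : Commute (ρ X) x := by
  set r : 𝔤 →ₗ[ℂ] Matrix (Fin d) (Fin d) ℂ := (ρ : 𝔤 →ₗ[ℂ] Matrix (Fin d) (Fin d) ℂ) with hr
  let E : Matrix (Fin d) (Fin d) ℂ →ₗ[ℂ] Matrix (Fin d) (Fin d) ℂ :=
    LinearMap.mulLeft ℂ x - LinearMap.mulRight ℂ x
  have hE (T : Matrix (Fin d) (Fin d) ℂ) : E T = x * T - T * x := rfl
  have h1 : leg1 x * Q - Q * leg1 x = killingTensor b (E ∘ₗ m) r := by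
    rw [hQ, leg1_mul_killingTensor, killingTensor_mul_leg1, ← killingTensor_sub_left]; rfl
  have h2 : Q * leg2 x - leg2 x * Q = killingTensor b r (-(E ∘ₗ m)) := by
    rw [killingTensor_neg_right, eq_neg_iff_add_eq_zero]
    have : killingTensor b r (E ∘ₗ m) = leg2 x * Q - Q * leg2 x := by
      rw [hQ', leg2_mul_killingTensor, killingTensor_mul_leg2, ← killingTensor_sub_right]; rfl
    rw [this]; abel
  have h3 : killingTensor b (E ∘ₗ m) r = killingTensor b r (-(E ∘ₗ m)) := by
    rw [← h1, ← h2, ← sub_eq_zero, ← sub_eq_zero.2 hc.eq.symm]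
    noncomm_ring
  have hplus (X : 𝔤) : E (ρ (X + α X)) = 0 := by rw [hE, (hx X).eq, sub_self]
  -- Split `X` into its `α`-even and `α`-odd halves: `E` kills the even one, and `h3` places the
  -- image of the odd one in the range.
  have hmem (X : 𝔤) : E (ρ X) ∈ LinearMap.range r := by
    have h4 : E (ρ X) = (1 / 2 : ℂ) • (E ∘ₗ m) X := by
      have : ρ X = (1 / 2 : ℂ) • ρ (X + α X) + (1 / 2 : ℂ) • m X := by
        rw [hm, ← map_smul, ← map_smul, ← map_add]
        congr 1
        module
      rw [this, map_add, map_smul, map_smul, hplus, smul_zero, zero_add]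
      rfl
    rw [h4]
    exact Submodule.smul_mem _ _ (mem_range_of_killingTensor_eq b (ρ := r) hρ h3 X)
  obtain ⟨π, hπ⟩ := r.exists_leftInverse_of_injective (LinearMap.ker_eq_bot.2 hρ)
  let δ : 𝔤 →ₗ[ℂ] 𝔤 := π ∘ₗ E ∘ₗ r
  have hδ (X : 𝔤) : ρ (δ X) = E (ρ X) := by
    obtain ⟨Y, hY⟩ := hmem X
    change ρ (π (E (ρ X))) = E (ρ X)
    rw [← hY]
    exact congrArg ρ (LinearMap.congr_fun hπ Y)
  let δ' : LieDerivation ℂ 𝔤 𝔤 :=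
    { δ with
      leibniz' := by
        intro X Y
        apply hρ
        change ρ (δ ⁅X, Y⁆) = ρ (⁅X, δ Y⁆ - ⁅Y, δ X⁆)
        simp only [hδ, map_sub, LieHom.map_lie, LieRing.of_associative_ring_bracket, hE]
        noncomm_ring }
  -- All derivations are inner because the Killing form is nondegenerate.
  obtain ⟨Y, hY⟩ := LieDerivation.IsKilling.exists_eq_ad δ'
  have hYδ (X : 𝔤) : δ X = ⁅Y, X⁆ := by
    have h := LieDerivation.congr_fun hY X
    have h' : LieDerivation.ad ℂ 𝔤 Y X = ⁅Y, X⁆ := by simp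
    exact h.symm.trans h'
  have hδanti (X Z : 𝔤) : killingForm ℂ 𝔤 (δ X) Z = -killingForm ℂ 𝔤 X (δ Z) := by
    rw [hYδ, hYδ, LieModule.traceForm_apply_lie_apply' ]
  let M : 𝔤 →ₗ[ℂ] 𝔤 := LinearMap.id - (α : 𝔤 →ₗ[ℂ] 𝔤)
  have hM (X : 𝔤) : M X = X - α X := rfl
  have hMadj (X Z : 𝔤) : killingForm ℂ 𝔤 (M X) Z = killingForm ℂ 𝔤 X (M Z) := by
    simp [hM, hadj]
  have hEm : E ∘ₗ m = r ∘ₗ (δ ∘ₗ M) := by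
    ext1 X
    change E (m X) = ρ (δ (M X))
    rw [hδ, hm, hM]
  have hδM (X Z : 𝔤) : killingForm ℂ 𝔤 (δ (M X)) Z = -killingForm ℂ 𝔤 X (δ (M Z)) := by
    rw [hEm, ← LinearMap.comp_neg] at h3
    have := killingForm_adjoint_of_killingTensor_eq b (ρ := r) hρ h3 X Z
    simpa using this
  -- Since `δ` is skew and `M` self-adjoint, the adjoint of `δ ∘ M` is `-(M ∘ δ)`; by `hδM` it is
  -- also `-(δ ∘ M)`.
  have hcomm (X : 𝔤) : δ (M X) = M (δ X) := killingForm_left_injective fun Z => by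
    rw [hδM, hMadj, hδanti]
  have hfix : α Y = Y := by
    have : α Y - Y ∈ LieAlgebra.center ℂ 𝔤 := by
      rw [LieModule.mem_maxTrivSubmodule]
      intro Z
      -- Evaluating at `α Z` and using `α² = 1` gives `⁅Y, Z⁆ = ⁅α Y, Z⁆`.
      have h5 := hcomm (α Z)
      simp only [hM, hYδ, lie_sub, LieEquiv.map_lie, hα] at h5
      rw [← lie_skew, sub_lie, neg_eq_zero, sub_eq_zero]
      exact (sub_right_injective h5).symm
    rw [LieAlgebra.center_eq_bot, LieSubmodule.mem_bot] at this
    exact sub_eq_zero.1 this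
  have hY0 : Y = 0 := by
    have hYc : (⟨Y, hfix⟩ : invariantSubalgebra α) ∈
        LieAlgebra.center ℂ (invariantSubalgebra α) := by
      rw [LieModule.mem_maxTrivSubmodule]
      rintro ⟨Z, hZ⟩
      have hZ' : α Z = Z := hZ
      apply Subtype.ext
      change ⁅Z, Y⁆ = 0
      -- As `x` commutes with `ρ(𝔥)`, the derivation `ad Y` vanishes on `𝔥`.
      have h6 : δ (Z + α Z) = 0 := hρ (by rw [hδ, hplus, map_zero])
      rw [hZ', ← two_smul ℂ, map_smul, hYδ] at h6
      rw [← lie_skew, (smul_eq_zero.1 h6).resolve_left two_ne_zero, neg_zero]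
    rw [hcenter, LieSubmodule.mem_bot] at hYc
    exact congrArg Subtype.val hYc
  have h7 := hδ X
  rw [hYδ, hY0, zero_lie, map_zero, hE] at h7
  exact sub_eq_zero.1 (by rw [← neg_sub, ← h7, neg_zero])

end Algebra

/-! ### Consequences of the asymptotic hypothesis, and the theorem -/

lemma tendsto_of_isBigO_inv {d : ℕ} {κt : ℂ → Matrix (Fin d) (Fin d) ℂ}
    {κ : Matrix (Fin d) (Fin d) ℂ}
    (h : ∀ i j, (fun u : ℂ => κt u i j - κ i j) =O[Bornology.cobounded ℂ] fun u : ℂ => u⁻¹) :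
    Tendsto κt (Bornology.cobounded ℂ) (𝓝 κ) :=
  tendsto_pi_nhds.2 fun i => tendsto_pi_nhds.2 fun j => by
    have h1 := ((h i j).trans_tendsto tendsto_inv₀_cobounded).add_const (κ i j)
    simpa using h1

/-- The bound `O(u⁻¹)` gives boundedness of `u (k u - 1)` but no limit at infinity, so a finer
filter is chosen by compactness. -/
lemma exists_tendsto_smul_sub_one {d : ℕ} {κt : ℂ → Matrix (Fin d) (Fin d) ℂ}
    {κ : Matrix (Fin d) (Fin d) ℂ} (hκ : IsUnit κ)
    (h : ∀ i j, (fun u : ℂ => κt u i j - κ i j) =O[Bornology.cobounded ℂ] fun u : ℂ => u⁻¹) :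
    ∃ F : Filter ℂ, F.NeBot ∧ F ≤ Bornology.cobounded ℂ ∧
      ∃ x, Tendsto (fun u => u • (κt u * κ⁻¹ - 1)) F (𝓝 x) := by
  obtain ⟨F, hF, hF', y, hy⟩ := exists_tendsto_of_isBigO_one
    (f := fun u => u • (κt u - κ)) fun i j => by
      have h1 := (Asymptotics.isBigO_refl (fun u : ℂ => u) (Bornology.cobounded ℂ)).mul (h i j)
      refine h1.trans (Asymptotics.IsBigO.of_bound 1 ?_)
      filter_upwards [Bornology.eventually_ne_cobounded 0] with u hu
      simp [hu]
  refine ⟨F, hF, hF', y * κ⁻¹, (hy.mul_const κ⁻¹).congr fun u => ?_⟩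
  rw [smul_mul_assoc, sub_mul, Matrix.mul_nonsing_inv _ ((Matrix.isUnit_iff_isUnit_det κ).1 hκ)]

end ClassicalBYBE

theorem mainTheorem9 {𝔤 : Type*} [LieRing 𝔤] [LieAlgebra ℂ 𝔤] [FiniteDimensional ℂ 𝔤]
    [LieAlgebra.IsSimple ℂ 𝔤]
    {ι : Type*} [Fintype ι] [DecidableEq ι] (b : Module.Basis ι ℂ 𝔤)
    {d : ℕ} (ρ₁ ρ₂ : 𝔤 →ₗ⁅ℂ⁆ Matrix (Fin d) (Fin d) ℂ)
    (hρ₁ : Function.Injective ρ₁) (hρ₂ : Function.Injective ρ₂)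
    (hirr : ClassicalBYBE.IsIrreducibleRep ρ₁)
    (D : Set ℂ) (hD : D ∈ Bornology.cobounded ℂ)
    (κt : ℂ → Matrix (Fin d) (Fin d) ℂ)
    (hκt : ClassicalBYBE.IsSolutionOn b ρ₁ ρ₂ κt D)
    (hzero : (0 : ℂ) ∈ D → D ∈ 𝓝 (0 : ℂ) ∧ ContinuousAt κt 0)
    (κ : Matrix (Fin d) (Fin d) ℂ) (hκ : IsUnit κ)
    (hasymp : ∀ i j, (fun u : ℂ => κt u i j - κ i j) =O[Bornology.cobounded ℂ] fun u : ℂ => u⁻¹)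
    (hnorm : ∀ u ∈ D, (κt u * κ⁻¹).trace = (d : ℂ)) :
    ∃ α : 𝔤 ≃ₗ⁅ℂ⁆ 𝔤,
      (∀ X, ρ₁ (α X) = κ * ρ₂ X * κ⁻¹) ∧ (∀ X, α (α X) = X) ∧
      (LieAlgebra.IsSemisimple ℂ (ClassicalBYBE.invariantSubalgebra α) → ∀ u ∈ D, κt u = κ) := by

  open ClassicalBYBE in
  have hdet := (Matrix.isUnit_iff_isUnit_det κ).1 hκ
  have hκ1 : κ * κ⁻¹ = 1 := Matrix.mul_nonsing_inv _ hdet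
  have hκ2 : κ⁻¹ * κ = 1 := Matrix.nonsing_inv_mul _ hdet
  have hk := hκt.clearedEquation b hκ
  have hlim : Filter.Tendsto (fun u => κt u * κ⁻¹) (Bornology.cobounded ℂ) (𝓝 1) := by
    have h := (tendsto_of_isBigO_inv hasymp).mul_const κ⁻¹
    rwa [hκ1] at h
  obtain ⟨hCC, hCC'⟩ := leading_order hD hk hlim
  obtain ⟨α, hα, hα2, hadj⟩ := exists_involution (b := b) hρ₁ (conjRep_injective hκ hρ₂) hCC'
  refine ⟨α, hα, hα2, fun hss => ?_⟩
  rw [← hCC, ← hCC'] at hk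
  set r : 𝔤 →ₗ[ℂ] Matrix (Fin d) (Fin d) ℂ := (ρ₁ : 𝔤 →ₗ[ℂ] Matrix (Fin d) (Fin d) ℂ) with hr
  set s : 𝔤 →ₗ[ℂ] Matrix (Fin d) (Fin d) ℂ :=
    (conjRep κ hκ ρ₂ : 𝔤 →ₗ[ℂ] Matrix (Fin d) (Fin d) ℂ) with hs
  have hsα (X : 𝔤) : s X = ρ₁ (α X) := (hα X).symm
  have hadd : killingTensor b r r + killingTensor b s r = killingTensor b (r + s) r :=
    (killingTensor_add_left b r s r).symm
  have hsub : killingTensor b r r - killingTensor b s r = killingTensor b (r - s) r :=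
    (killingTensor_sub_left b r s r).symm
  have hsub' : killingTensor b r r - killingTensor b s r = killingTensor b r (r - s) := by
    rw [hCC', killingTensor_sub_right]
  have hadd_apply (X : 𝔤) : (r + s) X = ρ₁ (X + α X) := by
    rw [map_add, ← hsα]; rfl
  have hsub_apply (X : 𝔤) : (r - s) X = ρ₁ (X - α X) := by
    rw [map_sub, ← hsα]; rfl
  obtain ⟨F, hFne, hF, x, hx⟩ := exists_tendsto_smul_sub_one hκ hasymp
  have hxplus (X : 𝔤) : Commute (ρ₁ (X + α X)) x := by
    rw [← hadd_apply]
    exact commute_of_commute_killingTensor hρ₁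
      (hadd ▸ commute_add_leg1_limit hD hk hlim hF hx) X
  have hxρ := commute_of_killingTensor_symmetric hρ₁ hα2 hadj
    (LieAlgebra.center_eq_bot ℂ (invariantSubalgebra α)) hxplus hsub_apply hsub hsub'
    (commute_sub_leg_limit hD hk hlim hF hx)
  have hxQ : Commute (killingTensor b r r - killingTensor b s r) (leg2 x) := by
    rw [hsub', commute_iff_eq, leg2_mul_killingTensor, killingTensor_mul_leg2]
    congr 1
    ext1 X
    change (r - s) X * x = x * (r - s) X
    rw [hsub_apply]
    exact (hxρ _).eq
  have hne (u : ℂ) (hu : u ∈ D) (hu0 : u ≠ 0) : κt u = κ := by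
    have h1 : Commute (killingTensor b r r - killingTensor b s r) (leg1 (κt u * κ⁻¹)) := by
      have h2 := second_order hD hk hlim hF hx hu
      have h3 : Commute (leg2 x) (leg1 (κt u * κ⁻¹)) := (leg1_commute_leg2 _ _).symm
      -- The right side of `second_order` vanishes because `leg2 x` commutes with both `Q` and `leg1
      -- (k u)`; what is left carries the factor `2u`, hence the restriction to `u ≠ 0`.
      rw [((hxQ.symm.mul_right h3).add_right (h3.mul_right hxQ.symm)).eq, sub_self] at h2
      exact sub_eq_zero.1 ((smul_eq_zero.1 h2).resolve_left (by simpa using hu0))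
    have h4 (X : 𝔤) : Commute (ρ₁ X) (κt u * κ⁻¹) := by
      have hm := commute_of_commute_killingTensor (f := r - s) hρ₁ (hsub ▸ h1) X
      have hp := commute_of_commute_killingTensor (f := r + s) hρ₁
        (hadd ▸ commute_add_leg1 hD hk hlim hu) X
      have h5 : ρ₁ X = (1 / 2 : ℂ) • ((r - s) X + (r + s) X) := by
        rw [hadd_apply, hsub_apply, ← map_add, ← map_smul]
        congr 1
        module
      rw [h5]
      exact (hm.add_left hp).smul_left _
    obtain ⟨c, hc⟩ := hirr.exists_eq_smul_one h4
    have hd : (d : ℂ) ≠ 0 := Nat.cast_ne_zero.2 hirr.1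
    have hc1 : c = 1 := by
      have h6 := hnorm u hu
      rw [hc, Matrix.trace_smul, Matrix.trace_one, Fintype.card_fin, smul_eq_mul] at h6
      exact mul_right_cancel₀ hd (by rw [h6, one_mul])
    rw [hc1, one_smul] at hc
    calc κt u = κt u * κ⁻¹ * κ := by rw [mul_assoc, hκ2, mul_one]
      _ = κ := by rw [hc, one_mul]
  intro u hu
  by_cases hu0 : u = 0
  · subst hu0
    obtain ⟨hD0, hcont⟩ := hzero hu
    -- Near `0` the function equals the constant `κ` off the origin, so continuity fixes its value
    -- there.
    have h7 : Filter.Tendsto κt (𝓝[≠] 0) (𝓝 (κt 0)) := hcont.tendsto.mono_left nhdsWithin_le_nhds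
    refine tendsto_nhds_unique h7 (tendsto_const_nhds.congr' ?_)
    filter_upwards [self_mem_nhdsWithin, mem_nhdsWithin_of_mem_nhds hD0] with v hv hvD
    exact (hne v hvD hv).symm
  · exact hne u hu hu0
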